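/- All modules are weighted graded $\mathbb{F}_2$-modules $M=\{M(w)_t\}_{w\in\mathbb{N},\,t\in\mathbb{Z}}$, with weight $w$ and internal degree $t$; write $|x|=t$ for $x\in M(w)_t$. An allowable $\bar{\mathcal R}$-module is a weighted graded $\mathbb{F}_2$-module $M$ with linear operations $\bar Q^j:M(w)_t\to M(2w)_{t+j-1}$, $j\in\mathbb{Z}$, such that for homogeneous $x$ one has $\bar Q^j x=0$ if $j<|x|$, and Behrens' relations $$\bar Q^r\bar Q^s x=\sum_{|x|\le l\le r-s-1}\binom{r-2l-1}{s-l}\bar Q^{r+s-l}\bar Q^l x\qquad (r\le 2s).$$ A shifted Lie bracket on $M$ is a family of bilinear maps $[-,-]:M(w)_t\otimes M(w')_{t'}\to M(w+w')_{t+t'-1}$ with $[x,y]=[y,x]$ and $[x,[y,z]]+[y,[z,x]]+[z,[x,y]]=0$. A $\mathrm{Lie}^s_{\bar{\mathcal R}}$-algebra is an allowable $\bar{\mathcal R}$-module with a shifted Lie bracket such that $[x,\bar Q^k y]=0$ for all $x,y,k$ and $[x,x]=\bar Q^{|x|}x$ for homogeneous $x$. A $\mathrm{Lie}^{s,\mathrm{ti}}_{\bar{\mathcal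 R}}$-algebra is an allowable $\bar{\mathcal R}$-module with a shifted Lie bracket $\langle-,-\rangle$ such that $\langle x,\bar Q^k y\rangle=0$ for all $x,y,k$ and $\langle x,x\rangle=0$. Denote by the same symbols the associated free algebra monads on weighted graded $\mathbb{F}_2$-modules. For such a monad $T$ and a $T$-algebra $A$, $\mathrm{Bar}_\bullet(\mathrm{id},T,A)$ is the simplicial module $n\mapsto T^nA$, where $\mathrm{id}$ is a right $T$-module through the augmentation $T\to\mathrm{id}$ onto the generators, and $\pi_{s,t}$ denotes its $s$-th homotopy group in internal degree $t$. For a $\mathrm{Lie}^s_{\bar{\mathcal R}}$-algebra $\mathfrak g$ let $V'\subset\mathfrak g$ be the ideal of self-brackets, i.e. the span of the elements $[x,x]$, and choose a weighted graded linear complement $W$, so that $\mathfrak g=V'\oplus W$ and $W\cong\mathfrak g/V'$. Let $\tilde{\mathfrak g}$ be the $\mathrm{Lie}^{s,\mathrm{ti}}_{\bar{\mathcal R}}$-algebra with the underlying $\bar{\mathcal R}$-module of $\mathfrak g$ and the product bracket of the zero bracket on $V'$ and the bracket of $\mathfrak g/V'$ on $W$; that is, $\langle x,y\rangle$ is the $W$-component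 of $[x,y]$. **Corollary.** Let $\mathfrak g$ be a $\mathrm{Lie}^s_{\bar{\mathcal R}}$-algebra concentrated in positive weights, i.e. $\mathfrak g(0)=0$, and let $\tilde{\mathfrak g}$ be formed with any choice of complement $W$. Then for all $s\ge 0$, $t\in\mathbb{Z}$ and all weights $w<4$ there is an isomorphism of $\mathbb{F}_2$-vector spaces $$\pi_{s,t}\mathrm{Bar}_\bullet(\mathrm{id},\mathrm{Lie}^s_{\bar{\mathcal R}},\mathfrak g)(w)\;\cong\;\pi_{s,t}\mathrm{Bar}_\bullet(\mathrm{id},\mathrm{Lie}^{s,\mathrm{ti}}_{\bar{\mathcal R}},\tilde{\mathfrak g})(w).$$ -/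

import Mathlib

open CategoryTheory

universe u

namespace LieR

/-- Weighted graded `𝔽₂`-modules: `M w t` is the part of weight `w` and internal degree `t`. -/
abbrev WMod : Type (u + 1) := ℕ → ℤ → ModuleCat.{u} (ZMod 2)

/-- Morphisms of weighted graded `𝔽₂`-modules: linear maps preserving weight and degree. -/
abbrev WHom (M N : WMod.{u}) : Type u := ∀ w t, M w t →ₗ[ZMod 2] N w t

/-- Weighted graded `𝔽₂`-modules with an allowable module structure over the algebra `R̄` of
operations `Q̄ʲ` (linear, internal degree `j - 1`, doubling the weight) and a shifted Lie bracket
(bilinear, internal degree `-1`, adding weights), such that brackets with a value of an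
operation vanish and `[x, x] = ε • Q̄^{|x|} x`.

* `ε = 1` is the notion of a `Lie^s_R̄`-algebra: `[x, x] = Q̄^{|x|} x = Q̄₀ x`.
* `ε = 0` is the notion of a `Lie^{s,ti}_R̄`-algebra: `[x, x] = 0` (totally isotropic bracket).

Source and target weights and degrees are related by equations, so that no transport along
equalities of weights or degrees is needed; signs are omitted since the characteristic is two. -/
structure Alg (ε : ZMod 2) where
  /-- The underlying weighted graded `𝔽₂`-module. -/
  M : WMod.{u}
  /-- The operation `Q̄ʲ`. -/
  Q : ∀ (j : ℤ) {w w' : ℕ} {t t' : ℤ}, w' = 2 * w → t' = t + j - 1 →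
    (M w t →ₗ[ZMod 2] M w' t')
  /-- The shifted Lie bracket. -/
  br : ∀ {w₁ w₂ w : ℕ} {t₁ t₂ t : ℤ}, w = w₁ + w₂ → t = t₁ + t₂ - 1 →
    (M w₁ t₁ →ₗ[ZMod 2] M w₂ t₂ →ₗ[ZMod 2] M w t)
  /-- Allowability: `Q̄ʲ x = 0` for `j < |x|`. (The vanishing of longer composites is a
  consequence of this and of `behrens`.) -/
  Q_eq_zero : ∀ (j : ℤ) {w w' : ℕ} {t t' : ℤ} (hw : w' = 2 * w) (ht : t' = t + j - 1)
    (x : M w t), j < t → Q j hw ht x = 0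
  /-- Behrens' relations `Q̄ʳ Q̄ˢ x = ∑ₗ (r - 2l - 1 choose s - l) Q̄^{r+s-l} Q̄ˡ x` for `r ≤ 2 s`.
  The binomial coefficient vanishes for `l > r - s - 1`, and `Q̄ˡ x` vanishes for `l < |x|`. In
  the remaining range `r - 2l - 1` and `s - l` are positive. -/
  behrens : ∀ (r s : ℤ), r ≤ 2 * s → ∀ {w w₁ w₂ : ℕ} {t t₂ : ℤ} (hw₁ : w₁ = 2 * w)
    (hw₂ : w₂ = 2 * w₁) (ht₂ : t₂ = t + r + s - 2) (x : M w t),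
    Q r hw₂ (t := t + s - 1) (t' := t₂) (by lia) (Q s hw₁ rfl x) =
      ∑ l ∈ Finset.Icc t (r - s - 1),
        (((r - 2 * l - 1).toNat.choose (s - l).toNat : ℕ) : ZMod 2) •
          Q (r + s - l) hw₂ (t := t + l - 1) (t' := t₂) (by lia) (Q l hw₁ rfl x)
  br_comm : ∀ {w₁ w₂ w : ℕ} {t₁ t₂ t : ℤ} (hw : w = w₁ + w₂) (ht : t = t₁ + t₂ - 1)
    (x : M w₁ t₁) (y : M w₂ t₂), br hw ht x y = br (by lia) (by lia) y x
  /-- The Jacobi identity `[x, [y, z]] + [y, [z, x]] + [z, [x, y]] = 0`. -/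
  jacobi : ∀ {w₁ w₂ w₃ w : ℕ} {t₁ t₂ t₃ t : ℤ} (hw : w = w₁ + w₂ + w₃)
    (ht : t = t₁ + t₂ + t₃ - 2) (x : M w₁ t₁) (y : M w₂ t₂) (z : M w₃ t₃),
    br (w := w) (t := t) (by lia) (by lia) x (br (w := w₂ + w₃) (t := t₂ + t₃ - 1) rfl rfl y z) +
      br (w := w) (t := t) (by lia) (by lia) y
        (br (w := w₃ + w₁) (t := t₃ + t₁ - 1) rfl rfl z x) +
      br (w := w) (t := t) (by lia) (by lia) z
        (br (w := w₁ + w₂) (t := t₁ + t₂ - 1) rfl rfl x y) = 0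
  br_Q : ∀ (k : ℤ) {w₁ w₂ w₂' w : ℕ} {t₁ t₂ t₂' t : ℤ} (hw : w = w₁ + w₂')
    (ht : t = t₁ + t₂' - 1) (hw' : w₂' = 2 * w₂) (ht' : t₂' = t₂ + k - 1)
    (x : M w₁ t₁) (y : M w₂ t₂), br hw ht x (Q k hw' ht' y) = 0
  br_self : ∀ {w w' : ℕ} {t t' : ℤ} (hw : w' = w + w) (ht : t' = t + t - 1) (x : M w t),
    br hw ht x x = ε • Q t (by lia) ht x

/-- `Lie^s_R̄`-algebras. -/
abbrev LieSR : Type (u + 1) := Alg.{u} 1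

/-- `Lie^{s,ti}_R̄`-algebras. -/
abbrev LieSTiR : Type (u + 1) := Alg.{u} 0

variable {ε : ZMod 2}

/-- The trivial algebra on a weighted graded module: all operations and brackets vanish. -/
def triv (ε : ZMod 2) (V : WMod.{u}) : Alg.{u} ε where
  M := V
  Q _ _ _ _ _ _ _ := 0
  br _ _ := 0
  Q_eq_zero := by intros; rfl
  behrens := by intros; simp
  br_comm := by intros; rfl
  jacobi := by intros; simp
  br_Q := by intros; rfl
  br_self := by intros; simp

/-! ### The free algebra -/

/-- Formal expressions in elements of `V`, sums, operations and brackets. -/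
inductive Term (V : WMod.{u}) : ℕ → ℤ → Type u
  | of {w : ℕ} {t : ℤ} : V w t → Term V w t
  | zero {w : ℕ} {t : ℤ} : Term V w t
  | add {w : ℕ} {t : ℤ} : Term V w t → Term V w t → Term V w t
  | Q (j : ℤ) {w w' : ℕ} {t t' : ℤ} (hw : w' = 2 * w) (ht : t' = t + j - 1) :
      Term V w t → Term V w' t'
  | br {w₁ w₂ w : ℕ} {t₁ t₂ t : ℤ} (hw : w = w₁ + w₂) (ht : t = t₁ + t₂ - 1) :
      Term V w₁ t₁ → Term V w₂ t₂ → Term V w t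

/-- The value of an expression in an algebra. -/
def Term.eval {V : WMod.{u}} (A : Alg.{u} ε) (f : WHom V A.M) :
    ∀ {w : ℕ} {t : ℤ}, Term V w t → A.M w t
  | _, _, .of v => f _ _ v
  | _, _, .zero => 0
  | _, _, .add a b => a.eval A f + b.eval A f
  | _, _, .Q j hw ht a => A.Q j hw ht (a.eval A f)
  | _, _, .br hw ht a b => A.br hw ht (a.eval A f) (b.eval A f)

/-- Two expressions are identified when they agree in every algebra under every linear
assignment of the generators, i.e. when the axioms force them to be equal. -/
def termSetoid (ε : ZMod 2) (V : WMod.{u}) (w : ℕ) (t : ℤ) : Setoid (Term V w t) where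
  r a b := ∀ (A : Alg.{u} ε) (f : WHom V A.M), a.eval A f = b.eval A f
  iseqv := ⟨fun _ _ _ => rfl, fun h A f => (h A f).symm, fun h h' A f => (h A f).trans (h' A f)⟩

/-- The underlying sets of the free algebra on `V`. -/
def FreeT (ε : ZMod 2) (V : WMod.{u}) (w : ℕ) (t : ℤ) : Type u := Quotient (termSetoid ε V w t)

namespace FreeT

variable {V : WMod.{u}} {w w₁ w₂ : ℕ} {t t₁ t₂ : ℤ}

/-- Evaluation of elements of the free algebra, as a plain function. -/
def evalFun (A : Alg.{u} ε) (f : WHom V A.M) (x : FreeT ε V w t) : A.M w t :=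
  Quotient.lift (fun a : Term V w t => a.eval A f) (fun _ _ (h : (termSetoid ε V w t).r _ _) => h A f) x

theorem ext {x y : FreeT ε V w t}
    (h : ∀ (A : Alg.{u} ε) (f : WHom V A.M), evalFun A f x = evalFun A f y) : x = y := by
  induction x using Quotient.inductionOn
  induction y using Quotient.inductionOn
  exact Quotient.sound h

instance : Zero (FreeT ε V w t) := ⟨Quotient.mk _ .zero⟩

instance : Add (FreeT ε V w t) :=
  ⟨Quotient.map₂ .add fun _ _ h _ _ h' A f => congrArg₂ (· + ·) (h A f) (h' A f)⟩

/-- The operations on the free algebra. -/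
def opQ (j : ℤ) (hw : w₁ = 2 * w) (ht : t₁ = t + j - 1) : FreeT ε V w t → FreeT ε V w₁ t₁ :=
  Quotient.map (.Q j hw ht) fun _ _ h A f => congrArg (A.Q j hw ht) (h A f)

/-- The bracket on the free algebra. -/
def opBr (hw : w = w₁ + w₂) (ht : t = t₁ + t₂ - 1) :
    FreeT ε V w₁ t₁ → FreeT ε V w₂ t₂ → FreeT ε V w t :=
  Quotient.map₂ (.br hw ht) fun _ _ h _ _ h' A f =>
    congrArg₂ (fun x y => A.br hw ht x y) (h A f) (h' A f)

/-- The class of a generator. -/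
def ofGen (v : V w t) : FreeT ε V w t := Quotient.mk _ (.of v)

theorem evalFun_ofGen (A : Alg.{u} ε) (f : WHom V A.M) (v : V w t) :
    evalFun A f (ofGen (ε := ε) v) = f w t v := rfl

theorem evalFun_zero (A : Alg.{u} ε) (f : WHom V A.M) :
    evalFun A f (0 : FreeT ε V w t) = 0 := rfl

theorem evalFun_add (A : Alg.{u} ε) (f : WHom V A.M) (x y : FreeT ε V w t) :
    evalFun A f (x + y) = evalFun A f x + evalFun A f y := by
  induction x using Quotient.inductionOn
  induction y using Quotient.inductionOn
  rfl

theorem evalFun_opQ (A : Alg.{u} ε) (f : WHom V A.M) (j : ℤ) (hw : w₁ = 2 * w)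
    (ht : t₁ = t + j - 1) (x : FreeT ε V w t) :
    evalFun A f (opQ j hw ht x) = A.Q j hw ht (evalFun A f x) := by
  induction x using Quotient.inductionOn
  rfl

theorem evalFun_opBr (A : Alg.{u} ε) (f : WHom V A.M) (hw : w = w₁ + w₂)
    (ht : t = t₁ + t₂ - 1) (x : FreeT ε V w₁ t₁) (y : FreeT ε V w₂ t₂) :
    evalFun A f (opBr hw ht x y) = A.br hw ht (evalFun A f x) (evalFun A f y) := by
  induction x using Quotient.inductionOn
  induction y using Quotient.inductionOn
  rfl

theorem add_self_eq_zero' (M : ModuleCat.{u} (ZMod 2)) (x : M) : x + x = 0 := by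
  have h : (2 : ZMod 2) • x = 0 := by
    rw [show (2 : ZMod 2) = 0 from rfl, zero_smul]
  rwa [two_smul] at h

instance : AddCommGroup (FreeT ε V w t) where
  add_assoc x y z := ext fun A f => by simp only [evalFun_add, add_assoc]
  zero_add x := ext fun A f => by simp only [evalFun_add, evalFun_zero, zero_add]
  add_zero x := ext fun A f => by simp only [evalFun_add, evalFun_zero, add_zero]
  add_comm x y := ext fun A f => by simp only [evalFun_add, add_comm]
  neg x := x
  neg_add_cancel x := ext fun A f => (evalFun_add A f x x).trans (add_self_eq_zero' _ _)
  nsmul := nsmulRec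
  zsmul := @zsmulRec _ _ _ ⟨fun x => x⟩ nsmulRec

instance : Module (ZMod 2) (FreeT ε V w t) :=
  AddCommGroup.zmodModule fun x => by
    rw [two_nsmul]
    exact neg_add_cancel x

/-- Evaluation of elements of the free algebra as a linear map. -/
def evalLin (A : Alg.{u} ε) (f : WHom V A.M) : FreeT ε V w t →ₗ[ZMod 2] A.M w t :=
  AddMonoidHom.toZModLinearMap 2
    { toFun := evalFun A f, map_zero' := evalFun_zero A f, map_add' := evalFun_add A f }

theorem evalLin_apply (A : Alg.{u} ε) (f : WHom V A.M) (x : FreeT ε V w t) :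
    evalLin A f x = evalFun A f x := rfl

theorem ext' {x y : FreeT ε V w t}
    (h : ∀ (A : Alg.{u} ε) (f : WHom V A.M), evalLin A f x = evalLin A f y) : x = y := ext h

/-- The operations on the free algebra as linear maps. -/
def linQ (j : ℤ) (hw : w₁ = 2 * w) (ht : t₁ = t + j - 1) :
    FreeT ε V w t →ₗ[ZMod 2] FreeT ε V w₁ t₁ :=
  AddMonoidHom.toZModLinearMap 2 (AddMonoidHom.mk' (opQ j hw ht) fun x y => ext fun A f => by
    simp only [evalFun_add, evalFun_opQ, map_add])

/-- The bracket on the free algebra as a bilinear map. -/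
def linBr (hw : w = w₁ + w₂) (ht : t = t₁ + t₂ - 1) :
    FreeT ε V w₁ t₁ →ₗ[ZMod 2] FreeT ε V w₂ t₂ →ₗ[ZMod 2] FreeT ε V w t :=
  AddMonoidHom.toZModLinearMap 2 (AddMonoidHom.mk'
    (fun x => AddMonoidHom.toZModLinearMap 2 (AddMonoidHom.mk' (opBr hw ht x)
      fun y z => ext fun A f => by simp only [evalFun_add, evalFun_opBr, map_add]))
    fun x y => LinearMap.ext fun z => ext fun A f => by
      change evalFun A f (opBr hw ht (x + y) z) = evalFun A f (opBr hw ht x z + opBr hw ht y z)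
      simp only [evalFun_add, evalFun_opBr, map_add, LinearMap.add_apply])

/-- The inclusion of the generators as a linear map. -/
def linOf : V w t →ₗ[ZMod 2] FreeT ε V w t :=
  AddMonoidHom.toZModLinearMap 2 (AddMonoidHom.mk' ofGen fun x y => ext fun A f => by
    simp only [evalFun_add, evalFun_ofGen, map_add])

theorem evalLin_linQ (A : Alg.{u} ε) (f : WHom V A.M) (j : ℤ) (hw : w₁ = 2 * w)
    (ht : t₁ = t + j - 1) (x : FreeT ε V w t) :
    evalLin A f (linQ j hw ht x) = A.Q j hw ht (evalLin A f x) := evalFun_opQ ..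

theorem evalLin_linBr (A : Alg.{u} ε) (f : WHom V A.M) (hw : w = w₁ + w₂)
    (ht : t = t₁ + t₂ - 1) (x : FreeT ε V w₁ t₁) (y : FreeT ε V w₂ t₂) :
    evalLin A f (linBr hw ht x y) = A.br hw ht (evalLin A f x) (evalLin A f y) :=
  evalFun_opBr ..

end FreeT

/-- The free algebra on a weighted graded module. -/
def free (ε : ZMod 2) (V : WMod.{u}) : Alg.{u} ε where
  M w t := ModuleCat.of (ZMod 2) (FreeT ε V w t)
  Q j _ _ _ _ hw ht := FreeT.linQ j hw ht
  br hw ht := FreeT.linBr hw ht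
  Q_eq_zero j _ _ _ _ hw ht x h := FreeT.ext' fun A f => by
    rw [FreeT.evalLin_linQ, A.Q_eq_zero j hw ht _ h, map_zero]
  behrens r s h _ _ _ _ _ hw₁ hw₂ ht₂ x := FreeT.ext' fun A f => by
    rw [map_sum]
    simp only [map_smul, FreeT.evalLin_linQ]
    exact A.behrens r s h hw₁ hw₂ ht₂ _
  br_comm hw ht x y := FreeT.ext' fun A f => by
    rw [FreeT.evalLin_linBr, FreeT.evalLin_linBr, A.br_comm]
  jacobi hw ht x y z := FreeT.ext' fun A f => by
    simp only [map_add, FreeT.evalLin_linBr, map_zero]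
    exact A.jacobi hw ht _ _ _
  br_Q k _ _ _ _ _ _ _ _ hw ht hw' ht' x y := FreeT.ext' fun A f => by
    rw [FreeT.evalLin_linBr, FreeT.evalLin_linQ, A.br_Q, map_zero]
  br_self hw ht x := FreeT.ext' fun A f => by
    rw [FreeT.evalLin_linBr, map_smul, FreeT.evalLin_linQ, A.br_self]

/-- The inclusion of the generators into the free algebra (the unit of the monad). -/
def unit (ε : ZMod 2) (V : WMod.{u}) : WHom V (free ε V).M := fun _ _ => FreeT.linOf

/-- The extension of a linear map `V → A` to the free algebra on `V`. -/
def lift {V : WMod.{u}} (A : Alg.{u} ε) (f : WHom V A.M) : WHom (free ε V).M A.M :=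
  fun _ _ => FreeT.evalLin A f

/-- Homomorphisms of algebras. -/
structure IsAlgHom (A B : Alg.{u} ε) (f : WHom A.M B.M) : Prop where
  map_Q : ∀ (j : ℤ) {w w' : ℕ} {t t' : ℤ} (hw : w' = 2 * w) (ht : t' = t + j - 1)
    (x : A.M w t), f w' t' (A.Q j hw ht x) = B.Q j hw ht (f w t x)
  map_br : ∀ {w₁ w₂ w : ℕ} {t₁ t₂ t : ℤ} (hw : w = w₁ + w₂) (ht : t = t₁ + t₂ - 1)
    (x : A.M w₁ t₁) (y : A.M w₂ t₂),
    f w t (A.br hw ht x y) = B.br hw ht (f w₁ t₁ x) (f w₂ t₂ y)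

theorem lift_isAlgHom {V : WMod.{u}} (A : Alg.{u} ε) (f : WHom V A.M) :
    IsAlgHom (free ε V) A (lift A f) :=
  ⟨fun j _ _ _ _ hw ht x => FreeT.evalLin_linQ A f j hw ht x,
    fun hw ht x y => FreeT.evalLin_linBr A f hw ht x y⟩

theorem lift_unit {V : WMod.{u}} (A : Alg.{u} ε) (f : WHom V A.M) (w : ℕ) (t : ℤ) (v : V w t) :
    lift A f w t (unit ε V w t v) = f w t v := rfl

/-- The universal property of the free algebra: uniqueness. -/
theorem lift_unique {V : WMod.{u}} (A : Alg.{u} ε) {f g : WHom (free ε V).M A.M}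
    (hf : IsAlgHom (free ε V) A f) (hg : IsAlgHom (free ε V) A g)
    (h : ∀ w t v, f w t (unit ε V w t v) = g w t (unit ε V w t v)) : f = g := by
  have key : ∀ {w : ℕ} {t : ℤ} (a : Term V w t),
      f w t (Quotient.mk (termSetoid ε V w t) a : FreeT ε V w t) =
        g w t (Quotient.mk (termSetoid ε V w t) a : FreeT ε V w t) := by
    intro w t a
    induction a with
    | of v => exact h _ _ v
    | zero => exact (map_zero (f _ _)).trans (map_zero (g _ _)).symm
    | add a b iha ihb =>
      exact ((map_add (f _ _) _ _).trans (congrArg₂ (· + ·) iha ihb)).trans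
        (map_add (g _ _) _ _).symm
    | Q j hw ht a ih =>
      exact ((hf.map_Q j hw ht _).trans (congrArg (A.Q j hw ht) ih)).trans
        (hg.map_Q j hw ht _).symm
    | br hw ht a b iha ihb =>
      exact ((hf.map_br hw ht _ _).trans
        (congrArg₂ (fun x y => A.br hw ht x y) iha ihb)).trans (hg.map_br hw ht _ _).symm
  funext w t
  refine LinearMap.ext fun x => ?_
  exact Quotient.inductionOn (motive := fun x : FreeT ε V w t => f w t x = g w t x) x key

/-! ### The monad and its bar construction -/

/-- The identity morphism. -/
def idHom (M : WMod.{u}) : WHom M M := fun _ _ => LinearMap.id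

/-- Composition of morphisms. -/
def comp {M N P : WMod.{u}} (g : WHom N P) (f : WHom M N) : WHom M P := fun w t =>
  (g w t).comp (f w t)

/-- The free algebra functor on morphisms. -/
def freeMap (ε : ZMod 2) {V W : WMod.{u}} (f : WHom V W) : WHom (free ε V).M (free ε W).M :=
  lift (free ε W) (comp (unit ε W) f)

/-- The structure map of an algebra over the free algebra monad. For a free algebra this is
the multiplication of the monad. -/
def structureMap (A : Alg.{u} ε) : WHom (free ε A.M).M A.M := lift A (idHom A.M)

/-- The augmentation of the free algebra monad, the projection onto the generators. -/
def augmentation (ε : ZMod 2) (V : WMod.{u}) : WHom (free ε V).M V := lift (triv ε V) (idHom V)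

/-- The simplicial level `n` of the bar construction `Bar(id, T, A)` for the free algebra monad
`T`, that is `Tⁿ A`, with its algebra structure coming from `A` (if `n = 0`) or from the
outermost `T` (if `n > 0`). -/
def bar (A : Alg.{u} ε) : ℕ → Alg.{u} ε
  | 0 => A
  | n + 1 => free ε (bar A n).M

/-- The face maps `dᵢ : Tⁿ⁺¹ A → Tⁿ A`, `0 ≤ i ≤ n + 1`, of `Bar(id, T, A)`: the face `d₀` is the
augmentation of the outermost `T`, the face `dᵢ` for `0 < i ≤ n` multiplies two adjacent copies
of `T`, and `dₙ₊₁` is the structure map of `A` on the innermost `T`. (The value for `i > n + 1` is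
irrelevant.) -/
def face (A : Alg.{u} ε) : ∀ n : ℕ, ℕ → WHom (bar A (n + 1)).M (bar A n).M
  | n, 0 => augmentation ε (bar A n).M
  | n, 1 => structureMap (bar A n)
  | 0, _ + 2 => fun _ _ => 0
  | n + 1, i + 2 => freeMap ε (face A n (i + 1))
termination_by structural _ k => k

theorem IsAlgHom.comp {A B C : Alg.{u} ε} {g : WHom B.M C.M} {f : WHom A.M B.M}
    (hg : IsAlgHom B C g) (hf : IsAlgHom A B f) : IsAlgHom A C (LieR.comp g f) :=
  ⟨fun j _ _ _ _ hw ht x => (congrArg (g _ _) (hf.map_Q j hw ht x)).trans (hg.map_Q j hw ht _),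
    fun hw ht x y => (congrArg (g _ _) (hf.map_br hw ht x y)).trans (hg.map_br hw ht _ _)⟩

theorem triv_isAlgHom {V W : WMod.{u}} (f : WHom V W) : IsAlgHom (triv ε V) (triv ε W) f :=
  ⟨fun _ _ _ _ _ _ _ _ => map_zero (f _ _), fun _ _ _ _ => map_zero (f _ _)⟩

theorem comp_lift {V : WMod.{u}} {A B : Alg.{u} ε} {g : WHom A.M B.M} (hg : IsAlgHom A B g)
    (f : WHom V A.M) : comp g (lift A f) = lift B (comp g f) :=
  lift_unique B (hg.comp (lift_isAlgHom A f)) (lift_isAlgHom B _) fun _ _ _ => rfl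

theorem lift_comp_freeMap {V W : WMod.{u}} (A : Alg.{u} ε) (g : WHom W A.M) (f : WHom V W) :
    comp (lift A g) (freeMap ε f) = lift A (comp g f) :=
  comp_lift (lift_isAlgHom A g) _

theorem freeMap_comp {U V W : WMod.{u}} (g : WHom V W) (f : WHom U V) :
    comp (freeMap ε g) (freeMap ε f) = freeMap ε (comp g f) :=
  lift_comp_freeMap (free ε W) _ f

/-- The simplicial identity `dᵢ dⱼ = dⱼ₋₁ dᵢ` for `i < j` (written with `j = k + 1`). -/
theorem face_comp_face (A : Alg.{u} ε) : ∀ (n i k : ℕ), i ≤ k → k ≤ n + 1 →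
    comp (face A n i) (face A (n + 1) (k + 1)) = comp (face A n k) (face A (n + 1) i)
  | n, 0, 0, _, _ =>
    (comp_lift (lift_isAlgHom (triv ε (bar A n).M) _) (idHom _)).trans
      (comp_lift (triv_isAlgHom (augmentation ε (bar A n).M)) (idHom _)).symm
  | n, 0, k + 1, _, _ =>
    (lift_comp_freeMap (triv ε (bar A n).M) (idHom _) (face A n (k + 1))).trans
      (comp_lift (triv_isAlgHom (face A n (k + 1))) (idHom _)).symm
  | n, 1, 1, _, _ =>
    (lift_comp_freeMap (bar A n) (idHom _) (face A n 1)).trans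
      (comp_lift (A := bar A (n + 1)) (lift_isAlgHom (bar A n) (idHom _)) (idHom _)).symm
  | 0, 1, _ + 2, _, h => by lia
  | n + 1, 1, k + 2, _, _ =>
    (lift_comp_freeMap (bar A (n + 1)) (idHom _) (face A (n + 1) (k + 2))).trans
      (comp_lift (A := bar A (n + 2)) (B := bar A (n + 1))
        (lift_isAlgHom (free ε (bar A n).M) _) (idHom _)).symm
  | 0, _ + 2, k, _, h => by lia
  | _ + 1, _ + 2, 0, h, _ => by lia
  | _ + 1, _ + 2, 1, h, _ => by lia
  | n + 1, i + 2, k + 2, h, h' =>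
    (freeMap_comp _ _).trans ((congrArg (freeMap ε)
      (face_comp_face A n (i + 1) (k + 1) (by lia) (by lia))).trans (freeMap_comp _ _).symm)

/-- The differential `∑ᵢ (-1)ⁱ dᵢ` of the chain complex associated with the simplicial module
`Bar(id, T, A)`; the signs are trivial over `𝔽₂`. -/
def barD (A : Alg.{u} ε) (w : ℕ) (t : ℤ) (n : ℕ) :
    (bar A (n + 1)).M w t ⟶ (bar A n).M w t :=
  ModuleCat.ofHom (∑ i ∈ Finset.range (n + 2), face A n i w t)

theorem barD_comp_barD (A : Alg.{u} ε) (w : ℕ) (t : ℤ) (n : ℕ) :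
    barD A w t (n + 1) ≫ barD A w t n = 0 := by
  apply ModuleCat.hom_ext
  refine LinearMap.ext fun x => ?_
  change (∑ i ∈ Finset.range (n + 2), face A n i w t)
    ((∑ j ∈ Finset.range (n + 3), face A (n + 1) j w t) x) = 0
  simp only [LinearMap.sum_apply, map_sum]
  rw [Finset.sum_comm, ← Finset.sum_product']
  have key : ∀ i k, i ≤ k → k ≤ n + 1 →
      face A n i w t (face A (n + 1) (k + 1) w t x) =
        face A n k w t (face A (n + 1) i w t x) := fun i k h h' =>
    congrArg (fun F : WHom (bar A (n + 2)).M (bar A n).M => F w t x)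
      (face_comp_face A n i k h h')
  refine Finset.sum_involution
    (fun p _ => if p.1 < p.2 then (p.2 - 1, p.1) else (p.2, p.1 + 1)) ?_ ?_ ?_ ?_
  · rintro ⟨i, j⟩ hp
    simp only [Finset.mem_product, Finset.mem_range] at hp
    by_cases hij : i < j
    · obtain ⟨k, rfl⟩ : ∃ k, j = k + 1 := ⟨j - 1, by lia⟩
      simp only [hij, if_true, Nat.add_sub_cancel]
      rw [key i k (by lia) (by lia)]
      exact FreeT.add_self_eq_zero' _ _
    · simp only [hij, if_false]
      rw [key j i (by lia) (by lia)]
      exact FreeT.add_self_eq_zero' _ _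
  · rintro ⟨i, j⟩ hp _ h
    by_cases hij : i < j
    · simp only [hij, if_true, Prod.mk.injEq] at h
      lia
    · simp only [hij, if_false, Prod.mk.injEq] at h
      lia
  · rintro ⟨i, j⟩ hp
    simp only [Finset.mem_product, Finset.mem_range] at hp ⊢
    split_ifs <;> dsimp only <;> lia
  · rintro ⟨i, j⟩ hp
    by_cases hij : i < j
    · have h : ¬ j - 1 < i := by lia
      simp only [hij, if_true, h, if_false, Prod.mk.injEq]
      lia
    · have h : j < i + 1 := by lia
      simp only [hij, if_false, h, if_true, Prod.mk.injEq]
      lia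

/-- The weight `w`, internal degree `t` part of the chain complex associated with the simplicial
module `Bar(id, T, A)`. -/
noncomputable def barComplex (A : Alg.{u} ε) (w : ℕ) (t : ℤ) :
    ChainComplex (ModuleCat.{u} (ZMod 2)) ℕ :=
  ChainComplex.of (fun n => (bar A n).M w t) (barD A w t) (barD_comp_barD A w t)

/-- The homotopy group `π_{s,t} Bar(id, T, A)` in weight `w`, where `T` is the free algebra monad
on weighted graded `𝔽₂`-modules of `Lie^s_R̄`-algebras if `ε = 1` and of `Lie^{s,ti}_R̄`-algebras if
`ε = 0`. -/
noncomputable def barHomotopy (A : Alg.{u} ε) (w s : ℕ) (t : ℤ) : ModuleCat.{u} (ZMod 2) :=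
  (barComplex A w t).homology s

/-! ### The totally isotropic structure on a `Lie^s_R̄`-algebra -/

/-- The ideal of self-brackets of a `Lie^s_R̄`-algebra. Since `[[x, x], y] = 0`, it is the span of
the elements `[x, x]`. -/
def selfBrackets (g : LieSR.{u}) (w : ℕ) (t : ℤ) : Submodule (ZMod 2) (g.M w t) :=
  Submodule.span (ZMod 2) {z | ∃ (w' : ℕ) (t' : ℤ) (hw : w = w' + w') (ht : t = t' + t' - 1)
    (x : g.M w' t'), g.br hw ht x x = z}

/-- A choice of a (weighted graded) linear complement of the ideal of self-brackets. -/
structure SelfBracketComplement (g : LieSR.{u}) where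
  /-- The complement. -/
  W : ∀ (w : ℕ) (t : ℤ), Submodule (ZMod 2) (g.M w t)
  isCompl : ∀ (w : ℕ) (t : ℤ), IsCompl (W w t) (selfBrackets g w t)

/-- The linear projection of `g` onto the complement of the self-brackets, along the
self-brackets. -/
noncomputable def SelfBracketComplement.proj {g : LieSR.{u}} (C : SelfBracketComplement g)
    (w : ℕ) (t : ℤ) : g.M w t →ₗ[ZMod 2] g.M w t :=
  (C.W w t).projection (selfBrackets g w t) (C.isCompl w t)

theorem br_selfBrackets (g : LieSR.{u}) {w₁ w₂ w : ℕ} {t₁ t₂ t : ℤ} (hw : w = w₁ + w₂)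
    (ht : t = t₁ + t₂ - 1) (x : g.M w₁ t₁) {z : g.M w₂ t₂} (hz : z ∈ selfBrackets g w₂ t₂) :
    g.br hw ht x z = 0 := by
  have h : selfBrackets g w₂ t₂ ≤ LinearMap.ker (g.br hw ht x) := by
    refine Submodule.span_le.2 ?_
    rintro _ ⟨w', t', hw', ht', y, rfl⟩
    rw [SetLike.mem_coe, LinearMap.mem_ker, g.br_self, one_smul, g.br_Q]
  exact h hz

theorem SelfBracketComplement.br_proj {g : LieSR.{u}} (C : SelfBracketComplement g)
    {w₁ w₂ w : ℕ} {t₁ t₂ t : ℤ} (hw : w = w₁ + w₂) (ht : t = t₁ + t₂ - 1)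
    (x : g.M w₁ t₁) (z : g.M w₂ t₂) : g.br hw ht x (C.proj w₂ t₂ z) = g.br hw ht x z := by
  have h := br_selfBrackets g hw ht x (Submodule.sub_projection_mem (C.isCompl w₂ t₂) z)
  rw [map_sub, sub_eq_zero] at h
  exact h.symm

theorem SelfBracketComplement.proj_self {g : LieSR.{u}} (C : SelfBracketComplement g)
    {w w' : ℕ} {t t' : ℤ} (hw : w' = w + w) (ht : t' = t + t - 1) (x : g.M w t) :
    C.proj w' t' (g.br hw ht x x) = 0 := by
  exact (Submodule.projection_apply_eq_zero_iff (C.isCompl w' t')).2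
    (Submodule.subset_span ⟨w, t, hw, ht, x, rfl⟩)

/-- The `Lie^{s,ti}_R̄`-algebra `g̃` associated with a `Lie^s_R̄`-algebra `g` and a splitting
`g = V' ⊕ W` with `V'` the ideal of self-brackets. The `R̄`-module is that of `g`. The bracket is that
of the product of `V'` with zero bracket and of `W ≅ g / V'` with the bracket induced by that
of `g`; as brackets with `V'` vanish, this means that `⟨x, y⟩` is the component of `[x, y]`
in `W`. -/
noncomputable def tilde (g : LieSR.{u}) (C : SelfBracketComplement g) : LieSTiR.{u} where
  M := g.M
  Q := g.Q
  br {_ _ w _ _ t} hw ht := (g.br hw ht).compr₂ (C.proj w t)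
  Q_eq_zero := g.Q_eq_zero
  behrens := g.behrens
  br_comm hw ht x y := by
    simp only [LinearMap.compr₂_apply]
    rw [g.br_comm]
  jacobi hw ht x y z := by
    simp only [LinearMap.compr₂_apply, C.br_proj, ← map_add]
    rw [g.jacobi hw ht, map_zero]
  br_Q k _ _ _ _ _ _ _ _ hw ht hw' ht' x y := by
    rw [LinearMap.compr₂_apply, g.br_Q, map_zero]
  br_self hw ht x := by
    rw [LinearMap.compr₂_apply, C.proj_self, zero_smul]

end LieR

/-! The two kinds of algebra differ only in `[x, x] = ε • Q̄^{|x|} x`. In positive weights below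
four, self-brackets occur only for `x` of weight one, with value in weight two. Over `𝔽₂`, squaring
is the identity, so a vector space has symmetric bilinear products with `x * x = x` (coordinatewise
multiplication in a basis). Given such a product on weight one, `Q̄ˢ (x * y)` is symmetric bilinear
with diagonal `Q̄ˢ x`; adding it to the bracket exchanges `ε = 0` and `ε = 1`. The Jacobi identity
survives: brackets kill values of operations, and an iterated bracket of elements of positive weight
has weight at least three, where there is no correction. Behrens' relations first appear in weight
four.

In weight one a free algebra is its module of generators, so a product on `A` passes to every `Tⁿ
A`. The augmentation and the structure map agree in weight one, hence all faces preserve these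
products. The twisted maps between the two bar constructions therefore commute with all faces
(`face_barTwist`). Twisting twice adds the correction twice, that is, not at all
(`barTwist_barTwist`), so the chain complexes are isomorphic.

It remains to find a product on `g` for which the correction is exactly the difference between the
given bracket and that of `tilde g C` (`exists_diag`). This difference is a combination of
self-brackets, so in weight two it lies in the image of `Q̄ˢ`, and an arbitrary idempotent product
can be adjusted by a section of `Q̄ˢ` over its image. The difference can be nonzero on elements of
distinct degrees `t₁`, `t₂` with `t₁ + t₂ = 2 s`, which is why a `Diag` pairs those as well. -/

namespace LieR

variable {ε ε' : ZMod 2}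

/-! ### Free algebras in weights zero and one -/

/-- Induction on elements of the free algebra. -/
theorem free_induction {V : WMod.{u}} {P : ∀ (w : ℕ) (t : ℤ), (free ε V).M w t → Prop}
    (of : ∀ w t (v : V w t), P w t (unit ε V w t v))
    (zero : ∀ w t, P w t 0)
    (add : ∀ w t (x y : (free ε V).M w t), P w t x → P w t y → P w t (x + y))
    (Q : ∀ (j : ℤ) {w w' : ℕ} {t t' : ℤ} (hw : w' = 2 * w) (ht : t' = t + j - 1)
      (x : (free ε V).M w t), P w t x → P w' t' ((free ε V).Q j hw ht x))
    (br : ∀ {w₁ w₂ w : ℕ} {t₁ t₂ t : ℤ} (hw : w = w₁ + w₂) (ht : t = t₁ + t₂ - 1)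
      (x : (free ε V).M w₁ t₁) (y : (free ε V).M w₂ t₂), P w₁ t₁ x → P w₂ t₂ y →
      P w t ((free ε V).br hw ht x y))
    {w : ℕ} {t : ℤ} (x : (free ε V).M w t) : P w t x := by
  have key : ∀ {w : ℕ} {t : ℤ} (a : Term V w t),
      P w t (Quotient.mk (termSetoid ε V w t) a : FreeT ε V w t) := by
    intro w t a
    induction a with
    | of v => exact of _ _ v
    | zero => exact zero _ _
    | add a b iha ihb => exact add _ _ _ _ iha ihb
    | Q j hw ht a ih => exact Q j hw ht _ ih
    | br hw ht a b iha ihb => exact br hw ht _ _ iha ihb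
  exact Quotient.inductionOn (motive := fun x : FreeT ε V w t => P w t x) x key

/-- A weighted graded module is concentrated in positive weights. -/
abbrev Positive (V : WMod.{u}) : Prop := ∀ t : ℤ, Subsingleton (V 0 t)

theorem Positive.eq_zero {V : WMod.{u}} (hV : Positive V) {w : ℕ} {t : ℤ} (h : w = 0)
    (x : V w t) : x = 0 := by
  subst h
  exact (hV t).elim _ _

theorem Positive.free {V : WMod.{u}} (hV : Positive V) (ε : ZMod 2) :
    Positive (free ε V).M := by
  have key : ∀ (w : ℕ) (t : ℤ) (x : (LieR.free ε V).M w t), w = 0 → x = 0 := by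
    intro w t x
    refine free_induction (P := fun w _ x => w = 0 → x = 0) ?_ ?_ ?_ ?_ ?_ x
    · intro w t v h
      rw [hV.eq_zero h v, map_zero]
    · intros; rfl
    · intro w t x y hx hy h
      rw [hx h, hy h, add_zero]
    · intro j w w' t t' hw ht x hx h
      rw [hx (by lia), map_zero]
    · intro w₁ w₂ w t₁ t₂ t hw ht x y hx _ h
      rw [hx (by lia), map_zero, LinearMap.zero_apply]
  exact fun t => ⟨fun x y => (key 0 t x rfl).trans (key 0 t y rfl).symm⟩

theorem augmentation_Q {V : WMod.{u}} (j : ℤ) {w w' : ℕ} {t t' : ℤ} (hw : w' = 2 * w)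
    (ht : t' = t + j - 1) (x : (free ε V).M w t) :
    augmentation ε V w' t' ((free ε V).Q j hw ht x) = 0 :=
  (lift_isAlgHom (triv ε V) (idHom V)).map_Q j hw ht x

theorem augmentation_br {V : WMod.{u}} {w₁ w₂ w : ℕ} {t₁ t₂ t : ℤ} (hw : w = w₁ + w₂)
    (ht : t = t₁ + t₂ - 1) (x : (free ε V).M w₁ t₁) (y : (free ε V).M w₂ t₂) :
    augmentation ε V w t ((free ε V).br hw ht x y) = 0 :=
  (lift_isAlgHom (triv ε V) (idHom V)).map_br hw ht x y

/-- In weight one, the free algebra consists of the generators. -/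
theorem unit_augmentation {V : WMod.{u}} (hV : Positive V) {t : ℤ} (x : (free ε V).M 1 t) :
    unit ε V 1 t (augmentation ε V 1 t x) = x := by
  have key : ∀ (w : ℕ) (t : ℤ) (x : (LieR.free ε V).M w t), w = 1 →
      unit ε V w t (augmentation ε V w t x) = x := by
    intro w t x
    refine free_induction
      (P := fun w t x => w = 1 → unit ε V w t (augmentation ε V w t x) = x) ?_ ?_ ?_ ?_ ?_ x
    · intros; rfl
    · intros; rw [map_zero, map_zero]
    · intro w t x y hx hy h
      rw [map_add, map_add, hx h, hy h]
    · intros; lia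
    · intro w₁ w₂ w t₁ t₂ t hw ht x y _ _ h
      obtain h | h : w₁ = 0 ∨ w₂ = 0 := by lia
      · rw [(hV.free ε).eq_zero h x, map_zero, LinearMap.zero_apply, map_zero, map_zero]
      · rw [(hV.free ε).eq_zero h y, map_zero, map_zero, map_zero]
  exact key 1 t x rfl

theorem structureMap_weight_one (A : Alg.{u} ε) (hA : Positive A.M) {t : ℤ}
    (x : (free ε A.M).M 1 t) : structureMap A 1 t x = augmentation ε A.M 1 t x := by
  conv_lhs => rw [← unit_augmentation hA x]
  rfl

theorem wmod_add_self {V : WMod.{u}} {w : ℕ} {t : ℤ} (x : V w t) : x + x = 0 :=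
  FreeT.add_self_eq_zero' _ x

/-! ### Idempotent products and the correction term -/

/-- A symmetric bilinear product on the weight one part of a weighted graded module, with values
in the average of the degrees, such that every element is idempotent. (The weights are related
by an equation so that no transport is needed.) -/
structure Diag (V : WMod.{u}) where
  /-- The product. -/
  c : ∀ {w₁ w₂ : ℕ} {t₁ t₂ s : ℤ}, w₁ + w₂ = 2 → t₁ + t₂ = 2 * s →
    (V w₁ t₁ →ₗ[ZMod 2] V w₂ t₂ →ₗ[ZMod 2] V 1 s)
  symm : ∀ {w₁ w₂ : ℕ} {t₁ t₂ s : ℤ} (hw : w₁ + w₂ = 2) (ht : t₁ + t₂ = 2 * s)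
    (x : V w₁ t₁) (y : V w₂ t₂), c hw ht x y = c (by lia) (by lia) y x
  self : ∀ {s : ℤ} (x : V 1 s), c (s := s) rfl (by lia) x x = x

/-- A morphism is multiplicative in weight one. -/
def Diag.Preserves {V W : WMod.{u}} (d : Diag V) (e : Diag W) (f : WHom V W) : Prop :=
  ∀ {w₁ w₂ : ℕ} {t₁ t₂ s : ℤ} (hw : w₁ + w₂ = 2) (ht : t₁ + t₂ = 2 * s)
    (x : V w₁ t₁) (y : V w₂ t₂), f 1 s (d.c hw ht x y) = e.c hw ht (f _ _ x) (f _ _ y)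

/-- The induced product on the weight one part of the free algebra. -/
def Diag.free {V : WMod.{u}} (d : Diag V) (hV : Positive V) (ε : ZMod 2) :
    Diag (free ε V).M where
  c {w₁ w₂ t₁ t₂ s} hw ht :=
    ((d.c hw ht).compl₁₂ (augmentation ε V w₁ t₁) (augmentation ε V w₂ t₂)).compr₂ (unit ε V 1 s)
  symm hw ht _ _ := congrArg (unit ε V _ _) (d.symm hw ht _ _)
  self x := (congrArg (unit ε V _ _) (d.self _)).trans (unit_augmentation hV x)

/-- The correction `Q̄ˢ (x y)` in weight two, where `x y` is the product in weight one. -/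
def corr (A : Alg.{u} ε) (d : Diag A.M) {w₁ w₂ w : ℕ} {t₁ t₂ t : ℤ} (hw : w = w₁ + w₂)
    (ht : t = t₁ + t₂ - 1) : A.M w₁ t₁ →ₗ[ZMod 2] A.M w₂ t₂ →ₗ[ZMod 2] A.M w t :=
  if h : w = 2 ∧ t % 2 = 1 then
    (d.c (s := (t + 1) / 2) (by lia) (by lia)).compr₂
      (A.Q ((t + 1) / 2) (w := 1) (t := (t + 1) / 2) (by lia) (by lia))
  else 0

section corr

variable (A : Alg.{u} ε) (d : Diag A.M) {w₁ w₂ w : ℕ} {t₁ t₂ t : ℤ} (hw : w = w₁ + w₂)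
  (ht : t = t₁ + t₂ - 1) (x : A.M w₁ t₁) (y : A.M w₂ t₂)

theorem corr_of_eq (h : w = 2 ∧ t % 2 = 1) :
    corr A d hw ht x y = A.Q ((t + 1) / 2) (w := 1) (t := (t + 1) / 2) (by lia) (by lia)
      (d.c (s := (t + 1) / 2) (by lia) (by lia) x y) := by
  rw [corr, dif_pos h]
  rfl

theorem corr_of_ne (h : ¬ (w = 2 ∧ t % 2 = 1)) : corr A d hw ht x y = 0 := by
  rw [corr, dif_neg h]
  rfl

theorem corr_comm : corr A d hw ht x y = corr A d (by lia) (by lia) y x := by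
  by_cases h : w = 2 ∧ t % 2 = 1
  · rw [corr_of_eq _ _ _ _ _ _ h, corr_of_eq _ _ _ _ _ _ h, d.symm]
  · rw [corr_of_ne _ _ _ _ _ _ h, corr_of_ne _ _ _ _ _ _ h]

/-- Below weight four a self-bracket has an argument of weight zero, where everything vanishes, or
of weight one, where idempotency of the product gives the value. -/
theorem corr_self (hA : Positive A.M) {w w' : ℕ} {t t' : ℤ} (hw : w' = w + w) (ht : t' = t + t - 1)
    (h4 : w' < 4) (x : A.M w t) : corr A d hw ht x x = A.Q t (by lia) ht x := by
  obtain rfl | rfl : w = 0 ∨ w = 1 := by lia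
  · rw [hA.eq_zero rfl x]
    simp only [map_zero]
  · obtain ⟨s, rfl⟩ : ∃ s, s = (t' + 1) / 2 := ⟨_, rfl⟩
    have hs : (t' + 1) / 2 = t := by lia
    rw [corr_of_eq _ _ _ _ _ _ (by lia)]
    subst hw
    generalize_proofs p1 p2 p3 p4 p5
    revert p1 p2 p3 p4 p5
    rw [hs]
    intros
    rw [d.self]

theorem br_corr {w₃ w₄ : ℕ} {t₃ t₄ : ℤ} (hw' : w₃ = w₄ + w) (ht' : t₃ = t₄ + t - 1)
    (z : A.M w₄ t₄) : A.br hw' ht' z (corr A d hw ht x y) = 0 := by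
  by_cases h : w = 2 ∧ t % 2 = 1
  · rw [corr_of_eq _ _ _ _ _ _ h, A.br_Q]
  · rw [corr_of_ne _ _ _ _ _ _ h, map_zero]

theorem map_corr {B : Alg.{u} ε'} (e : Diag B.M) (f : WHom A.M B.M)
    (hQ : ∀ (j : ℤ) {w w' : ℕ} {t t' : ℤ} (hw : w' = 2 * w) (ht : t' = t + j - 1)
      (x : A.M w t), w' < 4 → f w' t' (A.Q j hw ht x) = B.Q j hw ht (f w t x))
    (hf : d.Preserves e f) :
    f w t (corr A d hw ht x y) = corr B e hw ht (f w₁ t₁ x) (f w₂ t₂ y) := by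
  by_cases h : w = 2 ∧ t % 2 = 1
  · rw [corr_of_eq _ _ _ _ _ _ h, corr_of_eq _ _ _ _ _ _ h, hQ _ _ _ _ (by lia), hf]
  · rw [corr_of_ne _ _ _ _ _ _ h, corr_of_ne _ _ _ _ _ _ h, map_zero]

end corr

/-! ### Twisted algebras and twisted maps of free algebras -/

/-- Replace the bracket of an algebra of one type by one of the other type, by adding the
correction term, after making all operations with values in weights at least four vanish. -/
def twist (hε : ε' = ε + 1) (A : Alg.{u} ε) (hA : Positive A.M) (d : Diag A.M) :
    Alg.{u} ε' where
  M := A.M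
  Q j {_ w' _ _} hw ht := if w' < 4 then A.Q j hw ht else 0
  br {_ _ w _ _ _} hw ht := if w < 4 then A.br hw ht + corr A d hw ht else 0
  Q_eq_zero j w w' t t' hw ht x h := by
    split_ifs
    · exact A.Q_eq_zero j hw ht x h
    · rfl
  behrens r s h w w₁ w₂ t t₂ hw₁ hw₂ ht₂ x := by
    by_cases h4 : w₂ < 4
    · rw [hA.eq_zero (by lia) x]
      simp
    · simp [h4]
  br_comm {w₁ w₂ w t₁ t₂ t} hw ht x y := by
    split_ifs
    · rw [LinearMap.add_apply, LinearMap.add_apply, LinearMap.add_apply, LinearMap.add_apply,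
        A.br_comm, corr_comm]
    · rfl
  jacobi {w₁ w₂ w₃ w t₁ t₂ t₃ t} hw ht x y z := by
    by_cases h4 : w < 4
    · have key : ∀ {w₁ w₂ w₃ w v : ℕ} {t₁ t₂ t₃ t r : ℤ} (hw : w = w₁ + v)
          (ht : t = t₁ + r - 1) (hv : v = w₂ + w₃) (hr : r = t₂ + t₃ - 1)
          (x : A.M w₁ t₁) (y : A.M w₂ t₂) (z : A.M w₃ t₃),
          (A.br hw ht + corr A d hw ht) x ((A.br hv hr + corr A d hv hr) y z) =
            A.br hw ht x (A.br hv hr y z) := by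
        intro w₁ w₂ w₃ w v t₁ t₂ t₃ t r hw ht hv hr x y z
        -- Three positive weights add up to at least three, so the outer bracket has no correction;
        -- the inner correction is a value of an operation and is killed by `br_corr`.
        obtain h | h | h | h : w₁ = 0 ∨ w₂ = 0 ∨ w₃ = 0 ∨ ¬ (w = 2 ∧ t % 2 = 1) := by lia
        · simp [hA.eq_zero h x]
        · simp [hA.eq_zero h y]
        · simp [hA.eq_zero h z]
        · rw [LinearMap.add_apply, LinearMap.add_apply, corr_of_ne _ _ _ _ _ _ h, add_zero,
            LinearMap.add_apply, LinearMap.add_apply, map_add, br_corr, add_zero]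
      rw [if_pos h4, if_pos h4, if_pos h4, if_pos (by lia), if_pos (by lia), if_pos (by lia),
        key, key, key]
      exact A.jacobi hw ht x y z
    · simp [h4]
  br_Q k {w₁ w₂ w₂' w t₁ t₂ t₂' t} hw ht hw' ht' x y := by
    by_cases h4 : w < 4
    · rw [if_pos h4, if_pos (by lia)]
      -- For positive weights `w₁ + 2 * w₂` is at least three, so no correction occurs.
      obtain h | h | h : w₁ = 0 ∨ w₂ = 0 ∨ ¬ (w = 2 ∧ t % 2 = 1) := by lia
      · simp [hA.eq_zero h x]
      · simp [hA.eq_zero h y]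
      · rw [LinearMap.add_apply, LinearMap.add_apply, corr_of_ne _ _ _ _ _ _ h, add_zero, A.br_Q]
    · simp [h4]
  br_self {w w' t t'} hw ht x := by
    by_cases h4 : w' < 4
    · rw [if_pos h4, if_pos h4, LinearMap.add_apply, LinearMap.add_apply,
        corr_self A d hA hw ht h4, A.br_self, hε, add_smul, one_smul]
    · simp [h4]

/-- Homomorphisms, in weights below four, to an algebra of the other type with its twisted
bracket. -/
structure IsTwisted (A : Alg.{u} ε) (B : Alg.{u} ε') (e : Diag B.M) (f : WHom A.M B.M) :
    Prop where
  map_Q : ∀ (j : ℤ) {w w' : ℕ} {t t' : ℤ} (hw : w' = 2 * w) (ht : t' = t + j - 1)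
    (x : A.M w t), w' < 4 → f w' t' (A.Q j hw ht x) = B.Q j hw ht (f w t x)
  map_br : ∀ {w₁ w₂ w : ℕ} {t₁ t₂ t : ℤ} (hw : w = w₁ + w₂) (ht : t = t₁ + t₂ - 1)
    (x : A.M w₁ t₁) (y : A.M w₂ t₂), w < 4 →
    f w t (A.br hw ht x y) =
      B.br hw ht (f w₁ t₁ x) (f w₂ t₂ y) + corr B e hw ht (f w₁ t₁ x) (f w₂ t₂ y)

/-- The twisted homomorphism between free algebras induced by a linear map. -/
def freeTwist (hε : ε' = ε + 1) {V W : WMod.{u}} (hW : Positive W) (e : Diag W) (f : WHom V W) :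
    WHom (free ε' V).M (free ε W).M :=
  lift (twist hε (free ε W) (hW.free ε) (e.free hW ε)) (comp (unit ε W) f)

section freeTwist

variable (hε : ε' = ε + 1) {V W : WMod.{u}} (hW : Positive W) (e : Diag W) (f : WHom V W)

theorem freeTwist_unit {w : ℕ} {t : ℤ} (v : V w t) :
    freeTwist hε hW e f w t (unit ε' V w t v) = unit ε W w t (f w t v) := rfl

theorem freeTwist_isTwisted :
    IsTwisted (free ε' V) (free ε W) (e.free hW ε) (freeTwist hε hW e f) := by
  have h := lift_isAlgHom (twist hε (free ε W) (hW.free ε) (e.free hW ε)) (comp (unit ε W) f)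
  constructor
  · intro j w w' t t' hw ht x h4
    refine (h.map_Q j hw ht x).trans ?_
    simp only [twist, if_pos h4]
    rfl
  · intro w₁ w₂ w t₁ t₂ t hw ht x y h4
    refine (h.map_br hw ht x y).trans ?_
    simp only [twist, if_pos h4]
    rfl

/-- The correction is a value of an operation, hence decomposable, and the augmentation does not see
it. -/
theorem augmentation_freeTwist {w : ℕ} {t : ℤ} (hw : w < 4) (x : (free ε' V).M w t) :
    augmentation ε W w t (freeTwist hε hW e f w t x) = f w t (augmentation ε' V w t x) := by
  have ht := freeTwist_isTwisted hε hW e f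
  revert hw
  refine free_induction (P := fun w t x => w < 4 → augmentation ε W w t
    (freeTwist hε hW e f w t x) = f w t (augmentation ε' V w t x)) ?_ ?_ ?_ ?_ ?_ x
  · intros; rfl
  · intros; simp only [map_zero]
  · intro w t x y hx hy h
    simp only [map_add, hx h, hy h]
  · intro j w w' t t' hw ht' x _ h
    rw [ht.map_Q _ _ _ _ h, augmentation_Q, augmentation_Q, map_zero]
  · intro w₁ w₂ w t₁ t₂ t hw ht' x y _ _ h
    have h0 : augmentation ε W w t (corr (free ε W) (e.free hW ε) hw ht'
        (freeTwist hε hW e f _ _ x) (freeTwist hε hW e f _ _ y)) = 0 := by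
      by_cases h' : w = 2 ∧ t % 2 = 1
      · rw [corr_of_eq _ _ _ _ _ _ h', augmentation_Q]
      · rw [corr_of_ne _ _ _ _ _ _ h', map_zero]
    rw [ht.map_br _ _ _ _ h, map_add, h0, augmentation_br, augmentation_br, add_zero, map_zero]

theorem freeTwist_preserves {d : Diag V} (hV : Positive V) (hf : d.Preserves e f) :
    (d.free hV ε').Preserves (e.free hW ε) (freeTwist hε hW e f) := by
  intro w₁ w₂ t₁ t₂ s hw ht x y
  change unit ε W 1 s (f 1 s (d.c hw ht (augmentation ε' V _ _ x) (augmentation ε' V _ _ y))) =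
    unit ε W 1 s (e.c hw ht (augmentation ε W _ _ (freeTwist hε hW e f _ _ x))
      (augmentation ε W _ _ (freeTwist hε hW e f _ _ y)))
  rw [hf, augmentation_freeTwist hε hW e f (by lia), augmentation_freeTwist hε hW e f (by lia)]

end freeTwist

/-- On a bracket each of the two maps contributes the correction once. Since the second map
preserves products, the two contributions are equal and cancel in characteristic two. -/
theorem freeTwist_freeTwist (hε : ε' = ε + 1) (hε' : ε = ε' + 1) {V W : WMod.{u}}
    (hV : Positive V) (hW : Positive W) {d : Diag V} {e : Diag W} {f : WHom V W} {g : WHom W V}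
    (hg : e.Preserves d g) (h : ∀ w t, w < 4 → ∀ v : V w t, g w t (f w t v) = v)
    {w : ℕ} {t : ℤ} (hw : w < 4) (x : (free ε' V).M w t) :
    freeTwist hε' hV d g w t (freeTwist hε hW e f w t x) = x := by
  have tf := freeTwist_isTwisted hε hW e f
  have tg := freeTwist_isTwisted hε' hV d g
  revert hw
  refine free_induction (P := fun w t x => w < 4 →
    freeTwist hε' hV d g w t (freeTwist hε hW e f w t x) = x) ?_ ?_ ?_ ?_ ?_ x
  · intro w t v hw
    rw [freeTwist_unit, freeTwist_unit, h w t hw]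
  · intros; simp only [map_zero]
  · intro w t x y hx hy h
    simp only [map_add, hx h, hy h]
  · intro j w w' t t' hw ht' x hx h
    rw [tf.map_Q _ _ _ _ h, tg.map_Q _ _ _ _ h, hx (by lia)]
  · intro w₁ w₂ w t₁ t₂ t hw ht' x y hx hy h
    rw [tf.map_br _ _ _ _ h, map_add, tg.map_br _ _ _ _ h,
      map_corr _ _ _ _ _ _ (d.free hV ε') _ tg.map_Q (freeTwist_preserves hε' hV d g hW hg),
      hx (by lia), hy (by lia), add_assoc, wmod_add_self, add_zero]

/-! ### Compatibility of products and twisted maps with the face maps -/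

theorem augmentation_preserves {V : WMod.{u}} (hV : Positive V) (d : Diag V) :
    (d.free hV ε).Preserves d (augmentation ε V) := fun _ _ _ _ => rfl

/-- The product on the free algebra is defined through the augmentation, which agrees with the
structure map in weight one. -/
theorem structureMap_preserves (A : Alg.{u} ε) (hA : Positive A.M) (d : Diag A.M) :
    (d.free hA ε).Preserves d (structureMap A) := by
  intro w₁ w₂ t₁ t₂ s hw ht x y
  refine (structureMap_weight_one A hA _).trans ?_
  change d.c hw ht (augmentation ε A.M _ _ x) (augmentation ε A.M _ _ y) = _
  obtain rfl | rfl | rfl : w₁ = 0 ∨ w₂ = 0 ∨ w₁ = 1 := by lia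
  · simp only [(hA.free ε).eq_zero rfl x, map_zero, LinearMap.zero_apply]
  · simp only [(hA.free ε).eq_zero rfl y, map_zero]
  · obtain rfl : w₂ = 1 := by lia
    rw [structureMap_weight_one A hA, structureMap_weight_one A hA]

theorem augmentation_freeMap {V W : WMod.{u}} (f : WHom V W) {w : ℕ} {t : ℤ}
    (x : (free ε V).M w t) :
    augmentation ε W w t (freeMap ε f w t x) = f w t (augmentation ε V w t x) :=
  congrArg (fun F : WHom (free ε V).M W => F w t x)
    ((lift_comp_freeMap (triv ε W) (idHom _) f).trans
      (comp_lift (triv_isAlgHom f) (idHom _)).symm)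

theorem freeMap_preserves {V W : WMod.{u}} (hV : Positive V) (hW : Positive W) {d : Diag V}
    {e : Diag W} {f : WHom V W} (hf : d.Preserves e f) :
    (d.free hV ε).Preserves (e.free hW ε) (freeMap ε f) := by
  intro w₁ w₂ t₁ t₂ s hw ht x y
  change unit ε W 1 s (f 1 s (d.c hw ht (augmentation ε V _ _ x) (augmentation ε V _ _ y))) =
    unit ε W 1 s (e.c hw ht (augmentation ε W _ _ (freeMap ε f _ _ x))
      (augmentation ε W _ _ (freeMap ε f _ _ y)))
  rw [hf, augmentation_freeMap, augmentation_freeMap]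

theorem structureMap_isAlgHom (A : Alg.{u} ε) : IsAlgHom (free ε A.M) A (structureMap A) :=
  lift_isAlgHom A (idHom A.M)

theorem freeMap_isAlgHom {V W : WMod.{u}} (f : WHom V W) :
    IsAlgHom (free ε V) (free ε W) (freeMap ε f) :=
  lift_isAlgHom (free ε W) _

/-- Both composites turn a bracket into the bracket plus the correction on `B`: one because
`structureMap B` preserves products, the other because `f` is twisted. -/
theorem structureMap_freeTwist (hε : ε' = ε + 1) {A : Alg.{u} ε'} {B : Alg.{u} ε}
    (hB : Positive B.M) {e : Diag B.M}
    {f : WHom A.M B.M} (hf : IsTwisted A B e f) {w : ℕ} {t : ℤ} (hw : w < 4)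
    (x : (free ε' A.M).M w t) :
    structureMap B w t (freeTwist hε hB e f w t x) = f w t (structureMap A w t x) := by
  have tf := freeTwist_isTwisted hε hB e f
  have hm := structureMap_isAlgHom B
  have hm' := structureMap_isAlgHom A
  revert hw
  refine free_induction (P := fun w t x => w < 4 →
    structureMap B w t (freeTwist hε hB e f w t x) = f w t (structureMap A w t x))
    ?_ ?_ ?_ ?_ ?_ x
  · intros; rfl
  · intros; simp only [map_zero]
  · intro w t x y hx hy h
    simp only [map_add, hx h, hy h]
  · intro j w w' t t' hw ht' x hx h
    rw [tf.map_Q _ _ _ _ h, hm.map_Q, hm'.map_Q, hf.map_Q _ _ _ _ h, hx (by lia)]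
  · intro w₁ w₂ w t₁ t₂ t hw ht' x y hx hy h
    rw [tf.map_br _ _ _ _ h, map_add, hm.map_br,
      map_corr _ _ _ _ _ _ e _ (fun j _ _ _ _ hw ht x _ => hm.map_Q j hw ht x)
        (structureMap_preserves B hB e),
      hx (by lia), hy (by lia), hm'.map_br, hf.map_br _ _ _ _ h]

theorem freeMap_freeTwist (hε : ε' = ε + 1) {V V' W W' : WMod.{u}} (hV' : Positive V')
    (hW' : Positive W') {d' : Diag V'} {e' : Diag W'} {f : WHom V V'} {f' : WHom W W'}
    {h : WHom V W} {h' : WHom V' W'} (hh : d'.Preserves e' h')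
    (H : ∀ w t, w < 4 → ∀ v : V w t, h' w t (f w t v) = f' w t (h w t v))
    {w : ℕ} {t : ℤ} (hw : w < 4) (x : (free ε' V).M w t) :
    freeMap ε h' w t (freeTwist hε hV' d' f w t x) =
      freeTwist hε hW' e' f' w t (freeMap ε' h w t x) := by
  have tf := freeTwist_isTwisted hε hV' d' f
  have tf' := freeTwist_isTwisted hε hW' e' f'
  have hm : IsAlgHom _ _ (freeMap ε h') := freeMap_isAlgHom h'
  have hm' : IsAlgHom _ _ (freeMap ε' h) := freeMap_isAlgHom h
  revert hw
  refine free_induction (P := fun w t x => w < 4 → freeMap ε h' w t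
    (freeTwist hε hV' d' f w t x) = freeTwist hε hW' e' f' w t (freeMap ε' h w t x))
    ?_ ?_ ?_ ?_ ?_ x
  · intro w t v hw
    exact congrArg (unit ε W' w t) (H w t hw v)
  · intros; simp only [map_zero]
  · intro w t x y hx hy h
    simp only [map_add, hx h, hy h]
  · intro j w w' t t' hw ht' x hx h
    rw [tf.map_Q _ _ _ _ h, hm.map_Q, hm'.map_Q, tf'.map_Q _ _ _ _ h, hx (by lia)]
  · intro w₁ w₂ w t₁ t₂ t hw ht' x y hx hy h
    rw [tf.map_br _ _ _ _ h, map_add, hm.map_br,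
      map_corr _ _ _ _ _ _ (e'.free hW' ε) _ (fun j _ _ _ _ hw ht x _ => hm.map_Q j hw ht x)
        (freeMap_preserves hV' hW' hh),
      hx (by lia), hy (by lia), hm'.map_br, tf'.map_br _ _ _ _ h]

/-! ### Comparison of bar constructions -/

theorem bar_positive (A : Alg.{u} ε) (hA : Positive A.M) : ∀ n, Positive (bar A n).M
  | 0 => hA
  | n + 1 => (bar_positive A hA n).free ε

/-- The induced product on the weight one part of the bar construction. -/
def barDiag (A : Alg.{u} ε) (hA : Positive A.M) (d : Diag A.M) : ∀ n, Diag (bar A n).M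
  | 0 => d
  | n + 1 => (barDiag A hA d n).free (bar_positive A hA n) ε

theorem face_preserves (A : Alg.{u} ε) (hA : Positive A.M) (d : Diag A.M) :
    ∀ n i, i ≤ n + 1 → (barDiag A hA d (n + 1)).Preserves (barDiag A hA d n) (face A n i)
  | n, 0, _ => augmentation_preserves (bar_positive A hA n) (barDiag A hA d n)
  | n, 1, _ => structureMap_preserves (bar A n) (bar_positive A hA n) (barDiag A hA d n)
  | 0, _ + 2, h => by lia
  | n + 1, i + 2, h =>
    freeMap_preserves (bar_positive A hA (n + 1)) (bar_positive A hA n)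
      (face_preserves A hA d n (i + 1) (by lia))

/-- The maps of bar constructions induced by a twisted homomorphism. -/
def barTwist (hε : ε' = ε + 1) {A : Alg.{u} ε'} {B : Alg.{u} ε} (hB : Positive B.M)
    (e : Diag B.M) (f : WHom A.M B.M) : ∀ n, WHom (bar A n).M (bar B n).M
  | 0 => f
  | n + 1 => freeTwist hε (bar_positive B hB n) (barDiag B hB e n) (barTwist hε hB e f n)

section barTwist

variable (hε : ε' = ε + 1) {A : Alg.{u} ε'} {B : Alg.{u} ε} (hA : Positive A.M)
  (hB : Positive B.M) {d : Diag A.M} {e : Diag B.M} {f : WHom A.M B.M}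

theorem barTwist_isTwisted (hf : IsTwisted A B e f) :
    ∀ n, IsTwisted (bar A n) (bar B n) (barDiag B hB e n) (barTwist hε hB e f n)
  | 0 => hf
  | n + 1 => freeTwist_isTwisted hε (bar_positive B hB n) (barDiag B hB e n)
      (barTwist hε hB e f n)

theorem barTwist_preserves (hf : d.Preserves e f) :
    ∀ n, (barDiag A hA d n).Preserves (barDiag B hB e n) (barTwist hε hB e f n)
  | 0 => hf
  | n + 1 => freeTwist_preserves hε (bar_positive B hB n) (barDiag B hB e n)
      (barTwist hε hB e f n) (bar_positive A hA n) (barTwist_preserves hf n)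

theorem face_barTwist (hf : IsTwisted A B e f) {w : ℕ} {t : ℤ} (hw : w < 4) :
    ∀ n i, i ≤ n + 1 → ∀ x : (bar A (n + 1)).M w t,
      face B n i w t (barTwist hε hB e f (n + 1) w t x) =
        barTwist hε hB e f n w t (face A n i w t x)
  | n, 0, _, x => augmentation_freeTwist hε (bar_positive B hB n) (barDiag B hB e n)
      (barTwist hε hB e f n) hw x
  | n, 1, _, x => structureMap_freeTwist hε (bar_positive B hB n)
      (barTwist_isTwisted hε hB hf n) hw x
  | 0, _ + 2, h, _ => by lia
  | n + 1, i + 2, h, x =>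
    freeMap_freeTwist hε (bar_positive B hB (n + 1)) (bar_positive B hB n)
      (face_preserves B hB e n (i + 1) (by lia))
      (fun _ _ hw v => face_barTwist hf hw n (i + 1) (by lia) v) hw x

/-- With the roles of `A` and `B` exchanged, this makes the twisted maps mutually inverse in each
simplicial level. -/
theorem barTwist_barTwist (hε' : ε = ε' + 1) {g : WHom B.M A.M} (hg : e.Preserves d g)
    (h : ∀ w t, w < 4 → ∀ v : A.M w t, g w t (f w t v) = v) {w : ℕ} {t : ℤ} (hw : w < 4) :
    ∀ n (x : (bar A n).M w t),
      barTwist hε' hA d g n w t (barTwist hε hB e f n w t x) = x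
  | 0, x => h w t hw x
  | n + 1, x =>
    freeTwist_freeTwist hε hε' (bar_positive A hA n) (bar_positive B hB n)
      (barTwist_preserves hε' hB hA hg n)
      (fun _ _ hw v => barTwist_barTwist hε' hg h hw n v) hw x

theorem barD_barTwist (hf : IsTwisted A B e f) {w : ℕ} (hw : w < 4) (t : ℤ) (n : ℕ) :
    (∑ i ∈ Finset.range (n + 2), face B n i w t).comp (barTwist hε hB e f (n + 1) w t) =
      (barTwist hε hB e f n w t).comp (∑ i ∈ Finset.range (n + 2), face A n i w t) := by
  refine LinearMap.ext fun x => ?_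
  simp only [LinearMap.comp_apply, LinearMap.sum_apply, map_sum]
  exact Finset.sum_congr rfl fun i hi =>
    face_barTwist hε hB hf hw n i (Nat.lt_succ_iff.1 (Finset.mem_range.1 hi)) x

theorem barComplex_d (A : Alg.{u} ε) (w : ℕ) (t : ℤ) (n : ℕ) :
    (barComplex A w t).d (n + 1) n = barD A w t n :=
  ChainComplex.of_d (fun n => (bar A n).M w t) (barD A w t) n

/-- The map of chain complexes induced by a twisted homomorphism in weights below four. -/
noncomputable def barComplexMap (hf : IsTwisted A B e f) {w : ℕ} (hw : w < 4) (t : ℤ) :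
    barComplex A w t ⟶ barComplex B w t :=
  ChainComplex.ofHom (fun n => ModuleCat.ofHom (barTwist hε hB e f n w t))
    fun n => by
      refine (congrArg (_ ≫ ·) (barComplex_d B w t n)).trans
        (Eq.trans ?_ (congrArg (· ≫ _) (barComplex_d A w t n)).symm)
      exact ModuleCat.hom_ext (barD_barTwist hε hB hf hw t n)

theorem barComplexMap_comp (hε' : ε = ε' + 1) {g : WHom B.M A.M} (hf : IsTwisted A B e f)
    (hg' : IsTwisted B A d g) (hg : e.Preserves d g)
    (h : ∀ w t, w < 4 → ∀ v : A.M w t, g w t (f w t v) = v) {w : ℕ} (hw : w < 4) (t : ℤ) :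
    barComplexMap hε hB hf hw t ≫ barComplexMap hε' hA hg' hw t = 𝟙 _ := by
  refine HomologicalComplex.hom_ext _ _ fun n => ModuleCat.hom_ext (LinearMap.ext fun x => ?_)
  exact barTwist_barTwist hε hA hB hε' hg h hw n x

end barTwist

/-- Algebras of the two types on the same `R̄`-module, whose brackets differ by a correction term
in weights below four, have isomorphic bar constructions in these weights. -/
theorem nonempty_barHomotopy_iso (hε : ε' = ε + 1) {A : Alg.{u} ε'} {B : Alg.{u} ε}
    (hA : Positive A.M) (hB : Positive B.M) {d : Diag A.M} {e : Diag B.M} {f : WHom A.M B.M}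
    {g : WHom B.M A.M} (hf : IsTwisted A B e f) (hg : IsTwisted B A d g)
    (hf' : d.Preserves e f) (hg' : e.Preserves d g)
    (hfg : ∀ w t, w < 4 → ∀ v, g w t (f w t v) = v)
    (hgf : ∀ w t, w < 4 → ∀ v, f w t (g w t v) = v) {w : ℕ} (hw : w < 4) (s : ℕ) (t : ℤ) :
    Nonempty (barHomotopy A w s t ≅ barHomotopy B w s t) := by
  have hε' : ε = ε' + 1 := by
    rw [hε, add_assoc, CharTwo.add_self_eq_zero, add_zero]
  let i : barComplex A w t ≅ barComplex B w t :=
    ⟨barComplexMap hε hB hf hw t, barComplexMap hε' hA hg hw t,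
      barComplexMap_comp hε hA hB hε' hf hg hg' hfg hw t,
      barComplexMap_comp hε' hB hA hε hg hf hf' hgf hw t⟩
  exact ⟨(HomologicalComplex.homologyFunctor _ _ s).mapIso i⟩

/-! ### The correction term of a splitting -/

/-- Coordinatewise multiplication in a basis works, because `a * a = a` in `𝔽₂`. -/
theorem exists_idempotent_product (V : Type u) [AddCommGroup V] [Module (ZMod 2) V] :
    ∃ b : V →ₗ[ZMod 2] V →ₗ[ZMod 2] V, (∀ x y, b x y = b y x) ∧ ∀ x, b x x = x := by
  let B := Module.Basis.ofVectorSpace (ZMod 2) V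
  refine ⟨LinearMap.mk₂ (ZMod 2) (fun x y => B.repr.symm (B.repr x * B.repr y)) ?_ ?_ ?_ ?_,
    ?_, ?_⟩
  · intro x y z
    rw [map_add, add_mul, map_add]
  · intro c x y
    rw [← map_smul]
    refine congrArg (⇑B.repr.symm) (Finsupp.ext fun i => ?_)
    simp [mul_assoc]
  · intro x y z
    rw [map_add, mul_add, map_add]
  · intro c x y
    rw [← map_smul]
    refine congrArg (⇑B.repr.symm) (Finsupp.ext fun i => ?_)
    simp [mul_left_comm]
  · intro x y
    simp [mul_comm]
  · intro x
    have h : B.repr x * B.repr x = B.repr x := by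
      ext i
      have : ∀ a : ZMod 2, a * a = a := by decide
      simp [this]
    simp [h]

/-- A section of `q` over its range is extended to `W` through a retraction onto the range. -/
theorem exists_partial_section {V W : Type u} [AddCommGroup V] [Module (ZMod 2) V]
    [AddCommGroup W] [Module (ZMod 2) W] (q : V →ₗ[ZMod 2] W) :
    ∃ σ : W →ₗ[ZMod 2] V, ∀ x, q (σ (q x)) = q x := by
  obtain ⟨τ, hτ⟩ := q.rangeRestrict.exists_rightInverse_of_surjective q.range_rangeRestrict
  obtain ⟨p, hp⟩ := (LinearMap.range q).exists_isCompl
  obtain ⟨π, hπ⟩ := (LinearMap.range q).subtype.exists_leftInverse_of_injective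
    (LinearMap.range q).ker_subtype
  refine ⟨τ.comp π, fun x => ?_⟩
  have h1 : π (q x) = q.rangeRestrict x := LinearMap.congr_fun hπ (q.rangeRestrict x)
  have h2 := LinearMap.congr_fun hτ (q.rangeRestrict x)
  rw [LinearMap.comp_apply, h1]
  exact congrArg Subtype.val h2

/-- The projection of a weighted graded module onto one of its homogeneous parts. -/
def partProj (V : WMod.{u}) (w w' : ℕ) (t t' : ℤ) : V w t →ₗ[ZMod 2] V w' t' :=
  if h : w = w' ∧ t = t' then by
    obtain ⟨rfl, rfl⟩ := h
    exact LinearMap.id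
  else 0

theorem partProj_self (V : WMod.{u}) (w : ℕ) (t : ℤ) : partProj V w w t t = LinearMap.id := by
  rw [partProj, dif_pos ⟨rfl, rfl⟩]

theorem selfBrackets_le_range_Q (g : LieSR.{u}) (s : ℤ) :
    selfBrackets g 2 (s + s - 1) ≤
      LinearMap.range (g.Q s (w := 1) (w' := 2) (t := s) rfl rfl) := by
  refine Submodule.span_le.2 ?_
  rintro _ ⟨w', t', hw, ht, x, rfl⟩
  obtain rfl : w' = 1 := by lia
  obtain rfl : t' = s := by lia
  exact ⟨x, by rw [g.br_self, one_smul]⟩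

/-- Self-brackets have even weight and odd degree, so outside these cases only weight zero
contributes. -/
theorem selfBrackets_eq_bot (g : LieSR.{u}) (hg : Positive g.M) {w : ℕ} {t : ℤ} (hw : w < 4)
    (h : ¬ (w = 2 ∧ t % 2 = 1)) : selfBrackets g w t = ⊥ := by
  refine Submodule.span_eq_bot.2 ?_
  rintro _ ⟨w', t', hw', ht', x, rfl⟩
  rw [hg.eq_zero (by lia) x, map_zero]

section complement

variable {g : LieSR.{u}} (C : SelfBracketComplement g) {w₁ w₂ w : ℕ} {t₁ t₂ t : ℤ}

/-- The bracket of `tilde g C`, as a bracket on `g`. -/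
noncomputable def tildeBr (hw : w = w₁ + w₂) (ht : t = t₁ + t₂ - 1) :
    g.M w₁ t₁ →ₗ[ZMod 2] g.M w₂ t₂ →ₗ[ZMod 2] g.M w t :=
  (tilde g C).br hw ht

theorem tildeBr_comm (hw : w = w₁ + w₂) (ht : t = t₁ + t₂ - 1) (x : g.M w₁ t₁)
    (y : g.M w₂ t₂) : tildeBr C hw ht x y = tildeBr C (by lia) (by lia) y x :=
  (tilde g C).br_comm hw ht x y

theorem tildeBr_self {w w' : ℕ} {t t' : ℤ} (hw : w' = w + w) (ht : t' = t + t - 1)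
    (x : g.M w t) : tildeBr C hw ht x x = 0 :=
  C.proj_self hw ht x

theorem br_add_tildeBr_mem (hw : w = w₁ + w₂) (ht : t = t₁ + t₂ - 1) (x : g.M w₁ t₁)
    (y : g.M w₂ t₂) :
    g.br hw ht x y + tildeBr C hw ht x y ∈ selfBrackets g w t := by
  have h := Submodule.sub_projection_mem (C.isCompl w t) (g.br hw ht x y)
  rwa [← sub_add_cancel (g.br hw ht x y) (tildeBr C hw ht x y), add_assoc,
    wmod_add_self, add_zero]

theorem exists_diag :
    ∃ d : Diag g.M, ∀ {w₁ w₂ : ℕ} {t₁ t₂ s : ℤ} (hw : w₁ + w₂ = 2) (ht : t₁ + t₂ = 2 * s)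
      (x : g.M w₁ t₁) (y : g.M w₂ t₂),
      g.Q s (w' := 2) (t' := s + s - 1) rfl rfl (d.c hw ht x y) =
        g.br (by lia) (by lia) x y + tildeBr C (by lia) (by lia) x y := by
  choose b b_comm b_self using fun s : ℤ => exists_idempotent_product (g.M 1 s)
  choose σ hσ using fun s : ℤ =>
    exists_partial_section (g.Q s (w := 1) (w' := 2) (t := s) (t' := s + s - 1) rfl rfl)
  let β {w₁ w₂ : ℕ} {t₁ t₂ : ℤ} (s : ℤ) : g.M w₁ t₁ →ₗ[ZMod 2] g.M w₂ t₂ →ₗ[ZMod 2] g.M 1 s :=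
    (b s).compl₁₂ (partProj g.M w₁ 1 t₁ s) (partProj g.M w₂ 1 t₂ s)
  let c {w₁ w₂ : ℕ} {t₁ t₂ s : ℤ} (hw : w₁ + w₂ = 2) (ht : t₁ + t₂ = 2 * s) :
      g.M w₁ t₁ →ₗ[ZMod 2] g.M w₂ t₂ →ₗ[ZMod 2] g.M 1 s :=
    -- The basis product `β` has the right diagonal but in general the wrong value under `Q̄ˢ`. The
    -- error lies in the image of `Q̄ˢ`, so its lift along `σ` repairs the value.
    β s + (g.br (w := 2) (t := s + s - 1) (by lia) (by lia) +
      tildeBr C (w := 2) (t := s + s - 1) (by lia) (by lia) +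
      (β s).compr₂ (g.Q s (w' := 2) (t' := s + s - 1) rfl rfl)).compr₂ (σ s)
  have hc {w₁ w₂ : ℕ} {t₁ t₂ s : ℤ} (hw : w₁ + w₂ = 2) (ht : t₁ + t₂ = 2 * s)
      (x : g.M w₁ t₁) (y : g.M w₂ t₂) : c hw ht x y = β s x y +
        σ s (g.br (w := 2) (t := s + s - 1) (by lia) (by lia) x y +
          tildeBr C (w := 2) (t := s + s - 1) (by lia) (by lia) x y +
          g.Q s (w' := 2) (t' := s + s - 1) rfl rfl (β s x y)) := rfl
  have hβ {w₁ w₂ : ℕ} {t₁ t₂ s : ℤ} (x : g.M w₁ t₁) (y : g.M w₂ t₂) :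
      β s x y = β s y x := b_comm s _ _
  refine ⟨⟨c, ?_, ?_⟩, ?_⟩
  · intro w₁ w₂ t₁ t₂ s hw ht x y
    rw [hc hw ht, hc (by lia) (by lia), hβ x y, g.br_comm, tildeBr_comm]
  · intro s x
    have h : β s x x = x := by
      change b s (partProj g.M 1 1 s s x) (partProj g.M 1 1 s s x) = x
      rw [partProj_self]
      exact b_self s x
    -- On the diagonal the error vanishes: `[x, x] = Q̄ˢ x`, `⟨x, x⟩ = 0` and `β x x = x`, so
    -- idempotency is kept.
    rw [hc rfl (by lia), h, g.br_self rfl rfl, one_smul, tildeBr_self, add_zero,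
      wmod_add_self, map_zero, add_zero]
  · intro w₁ w₂ t₁ t₂ s hw ht x y
    obtain ⟨z, hz⟩ := selfBrackets_le_range_Q g s
      (br_add_tildeBr_mem C (w := 2) (t := s + s - 1) (by lia) (by lia) x y)
    change g.Q s _ _ (c hw ht x y) = _
    rw [hc hw ht, ← hz, ← map_add, map_add, hσ, map_add, add_left_comm, wmod_add_self, add_zero]

/-- In weight two and odd degree this is the defining property of `d`; elsewhere below weight four
there are no self-brackets, so the two brackets agree. -/
theorem br_eq_tildeBr_add_corr (hg : Positive g.M) {d : Diag g.M}
    (hd : ∀ {w₁ w₂ : ℕ} {t₁ t₂ s : ℤ} (hw : w₁ + w₂ = 2) (ht : t₁ + t₂ = 2 * s)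
      (x : g.M w₁ t₁) (y : g.M w₂ t₂),
      g.Q s (w' := 2) (t' := s + s - 1) rfl rfl (d.c hw ht x y) =
        g.br (by lia) (by lia) x y + tildeBr C (by lia) (by lia) x y)
    (h4 : w < 4) (hw : w = w₁ + w₂) (ht : t = t₁ + t₂ - 1) (x : g.M w₁ t₁) (y : g.M w₂ t₂) :
    g.br hw ht x y = tildeBr C hw ht x y + corr g d hw ht x y := by
  have key : corr g d hw ht x y = g.br hw ht x y + tildeBr C hw ht x y := by
    by_cases h : w = 2 ∧ t % 2 = 1
    · obtain ⟨rfl, h⟩ := h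
      obtain ⟨s, rfl⟩ : ∃ s, t = s + s - 1 := ⟨(t + 1) / 2, by lia⟩
      rw [corr_of_eq _ _ _ _ _ _ ⟨rfl, h⟩, ← hd (by lia) (by lia)]
      generalize_proofs p1 p2 p3 p4 p5
      revert p1 p2 p3 p4 p5
      rw [show (s + s - 1 + 1) / 2 = s by lia]
      intros
      rfl
    · have := br_add_tildeBr_mem C hw ht x y
      rw [selfBrackets_eq_bot g hg h4 h, Submodule.mem_bot] at this
      rw [corr_of_ne _ _ _ _ _ _ h, this]
  rw [key, add_left_comm, wmod_add_self, add_zero]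

end complement

end LieR

theorem mainTheorem4 (g : LieR.LieSR.{u}) (hg : ∀ t : ℤ, Subsingleton (g.M 0 t))
    (C : LieR.SelfBracketComplement g) (w : ℕ) (hw : w < 4) (s : ℕ) (t : ℤ) :
    Nonempty (LieR.barHomotopy g w s t ≅ LieR.barHomotopy (LieR.tilde g C) w s t) := by
  -- Both algebras have the same underlying module, and with the same `d` on both sides the identity
  -- is twisted in each direction.
  obtain ⟨d, hd⟩ := LieR.exists_diag C
  refine LieR.nonempty_barHomotopy_iso (A := g) (B := LieR.tilde g C) (d := d) (e := d)
    (f := LieR.idHom g.M) (g := LieR.idHom g.M) rfl hg hg ⟨fun _ _ _ _ _ _ _ _ _ => rfl, ?_⟩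
    ⟨fun _ _ _ _ _ _ _ _ _ => rfl, ?_⟩ (fun _ _ _ _ => rfl) (fun _ _ _ _ => rfl)
    (fun _ _ _ _ => rfl) (fun _ _ _ _ => rfl) hw s t
  · intro w₁ w₂ w t₁ t₂ t hw ht x y h4
    exact LieR.br_eq_tildeBr_add_corr C hg hd h4 hw ht x y
  · intro w₁ w₂ w t₁ t₂ t hw ht x y h4
    have h := LieR.br_eq_tildeBr_add_corr C hg hd h4 hw ht x y
    refine Eq.trans ?_ (congrArg (· + LieR.corr g d hw ht x y) h.symm)
    exact ((add_assoc _ _ _).trans ((congrArg _ (LieR.wmod_add_self _)).trans (add_zero _))).symm
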